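/- Throughout, "category" and "functor" mean $\mathsf{Pos}$-enriched category and functor: hom-sets are posets, composition is monotone in both variables, functors are locally monotone. **Conventions.** Let $\mathcal C$ be a weakly lex category, i.e. for every diagram $D\colon\mathcal D\to\mathcal C$ and every finite weight $W\colon\mathcal D\to\mathsf{Pos}$ ($\mathcal D$ has finitely many isomorphism classes of objects, finite hom-posets, and every $Wd$ is finite) there is a weak limit: an object $L$ with a natural transformation $W\to\mathcal C(L,D-)$ such that every induced map $\mathcal C(X,L)\to[\mathcal D,\mathsf{Pos}](W,\mathcal C(X,D-))$ is surjective. A *pseudocongruence* $(X,R)$ in $\mathcal C$ is a parallel pair $r_0,r_1\colon R\rightrightarrows X$ such that (1) every pair $a_0\le a_1\colon A\to X$ factors through $(r_0,r_1)$, and (2) for a weak pullback $d_0,d_1\colon R*R\rightrightarrows R$ with $r_1d_0=r_0d_1$ there is $\tau\colon R*R\to R$ with $r_0\tau=r_0d_0$, $r_1\tau=r_1d_1$. The category $\mathcal C_{\rm ex}$ has the pseudocongruences as objects. A morphism $(X,R)\to(Y,S)$ is an equivalence class $[f]$ of morphisms $f\colon X\to Y$ for which there is $\bar f\colon R\to S$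 with $s_0\bar f=fr_0$, $s_1\bar f=fr_1$; one puts $[f]\le[g]$ iff there is $\Sigma\colon X\to S$ with $s_0\Sigma=f$, $s_1\Sigma=g$, and $[f]=[g]$ iff $[f]\le[g]\le[f]$. Choose for every $X\in\mathcal C$ a weak comma square $i_0,i_1\colon I_X\rightrightarrows X$ of $(1_X,1_X)$, i.e. $i_0\le i_1$ and every pair $a_0\le a_1\colon A\to X$ factors through $(i_0,i_1)$. The functor $\Gamma\colon\mathcal C\to\mathcal C_{\rm ex}$ is $\Gamma X=(X,I_X)$, $\Gamma f=[f]$. In any category, $m$ is an *order-monomorphism* if $mf\le mg$ implies $f\le g$; $e\colon A\to B$ is an *$\mathsf{so}$-morphism* if for every order-monomorphism $m\colon X\to Y$ the map $\mathcal C(B,X)\to\mathcal C(A,X)\times_{\mathcal C(A,Y)}\mathcal C(B,Y)$, $w\mapsto(we,mw)$, is an isomorphism of posets; $P$ is *$\mathsf{so}$-projective* if $\mathcal C(P,-)$ sends $\mathsf{so}$-morphisms to surjections. A category is *regular* if it has all finite (weighted) limits, every morphism factors as an $\mathsf{so}$-morphism followed by an order-monomorphism, and $\mathsf{so}$-morphisms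 are stable under pullback. A full subcategory $\mathcal P$ of a regular category is a *projective cover* if all its objects are $\mathsf{so}$-projective and every object admits an $\mathsf{so}$-morphism from an object of $\mathcal P$. A *coinserter* of $(f,g)\colon X\rightrightarrows Y$ is a universal $q\colon Y\to Q$ with $qf\le qg$: every $h$ with $hf\le hg$ factors through $q$, and $kq\le k'q$ implies $k\le k'$. **Proposition.** Let $\mathcal C$ be weakly lex. A choice of weak comma squares as above exists, and for every such choice: 1. For every $A\in\mathcal C$, the object $\Gamma A=(A,I_A)$ is $\mathsf{so}$-projective in $\mathcal C_{\rm ex}$. 2. $\Gamma$ is full and $f\le g\iff\Gamma f\le\Gamma g$, and its essential image is a projective cover of the (regular) category $\mathcal C_{\rm ex}$; that is, $\mathcal C$ is via $\Gamma$ a projective cover of $\mathcal C_{\rm ex}$. 3. For every object $(X,R)$ of $\mathcal C_{\rm ex}$, the morphism $[1_X]\colon\Gamma X\to(X,R)$ is an $\mathsf{so}$-morphism and is the coinserter of $(\Gamma r_0,\Gamma r_1)\colon\Gamma R\rightrightarrows\Gamma X$. 4. Every morphism $(X,R)\to(Y,S)$ of $\mathcal C_{\rm ex}$ is of the form $[f]$,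 and for every representative $f$ there is $\bar f\colon R\to S$ with $s_i\bar f=fr_i$; for each such $f$ and $\bar f$ one has $\Gamma s_i\circ\Gamma\bar f=\Gamma f\circ\Gamma r_i$ ($i=0,1$) and $[1_Y]\circ\Gamma f=[f]\circ[1_X]$, so that $[f]$ is part of a commutative diagram whose rows are the coinserters of item 3. -/

import Mathlib

open CategoryTheory

universe v v' u u'

/-! ### Categories and functors enriched in posets -/

/-- The data making an ordinary category a category enriched in posets: a partial order on each
hom-set such that composition is monotone in both variables. -/
class PosEnriched (C : Type u) [Category.{v} C] where
  homOrder : ∀ X Y : C, PartialOrder (X ⟶ Y)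
  comp_mono : ∀ {X Y Z : C} {f f' : X ⟶ Y} {g g' : Y ⟶ Z},
    f ≤ f' → g ≤ g' → f ≫ g ≤ f' ≫ g'

attribute [reducible, instance] PosEnriched.homOrder

/-- Posets and monotone maps, with the pointwise order on monotone maps. -/
instance partOrdPosEnriched : PosEnriched PartOrd.{u} where
  homOrder X Y := PartialOrder.lift (fun f : X ⟶ Y => (f.hom : X →o Y))
    (fun _ _ h => ConcreteCategory.hom_injective h)
  comp_mono {_ _ _ _ f' g _} hf hg := fun x =>
    le_trans (g.hom.monotone (hf x)) (hg (f'.hom x))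

/-- Poset-enriched (that is, locally monotone) functors. -/
structure PosFunctor (C : Type u) [Category.{v} C] [PosEnriched C]
    (D : Type u') [Category.{v'} D] [PosEnriched D] extends C ⥤ D where
  map_mono : ∀ {X Y : C} {f g : X ⟶ Y}, f ≤ g → map f ≤ map g

/-! ### Weighted limits, strong and weak -/

section Weighted

variable {D : Type u'} [Category.{v'} D] [PosEnriched D]
variable {C : Type u} [Category.{v} C] [PosEnriched C]

/-- A natural transformation `W ⟶ C(X, F -)` of poset-enriched functors `D ⟶ Pos`. -/
@[ext]
structure WeightedCone (W : PosFunctor D PartOrd.{0}) (F : PosFunctor D C) (X : C) where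
  app : ∀ d : D, W.obj d → (X ⟶ F.obj d)
  mono : ∀ d : D, Monotone (app d)
  naturality : ∀ {d d' : D} (g : d ⟶ d') (x : W.obj d),
    app d' (W.map g x) = app d x ≫ F.map g

namespace WeightedCone

variable {W : PosFunctor D PartOrd.{0}} {F : PosFunctor D C}

/-- The pointwise order: the order of the hom-poset `[D, Pos](W, C(X, F -))`. -/
instance (X : C) : PartialOrder (WeightedCone W F X) :=
  PartialOrder.lift WeightedCone.app (fun _ _ h => WeightedCone.ext h)

/-- Restriction of a cone along a morphism. -/
def precomp {X L : C} (c : WeightedCone W F L) (h : X ⟶ L) : WeightedCone W F X where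
  app d x := h ≫ c.app d x
  mono d _ _ hxy := PosEnriched.comp_mono le_rfl (c.mono d hxy)
  naturality g x := by rw [c.naturality, Category.assoc]

/-- `c` exhibits `L` as a weak `W`-weighted limit of `F`: the comparison map
`C(X, L) ⟶ [D, Pos](W, C(X, F -))` is surjective for all `X`. -/
def IsWeakLimit {L : C} (c : WeightedCone W F L) : Prop :=
  ∀ X : C, Function.Surjective (fun h : X ⟶ L => c.precomp h)

/-- `c` exhibits `L` as the `W`-weighted limit of `F`: the comparison map
`C(X, L) ⟶ [D, Pos](W, C(X, F -))` is an isomorphism of posets for all `X`. -/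
def IsLimit {L : C} (c : WeightedCone W F L) : Prop :=
  ∀ X : C, Function.Surjective (fun h : X ⟶ L => c.precomp h) ∧
    ∀ h h' : X ⟶ L, c.precomp h ≤ c.precomp h' ↔ h ≤ h'

end WeightedCone

/-- A finite weight: finitely many isomorphism classes of objects in the indexing category, finite
hom-posets, and finite values. -/
structure PosFunctor.IsFiniteWeight (W : PosFunctor D PartOrd.{0}) : Prop where
  finite_objects : ∃ s : Set D, s.Finite ∧ ∀ d : D, ∃ d' ∈ s, Nonempty (d ≅ d')
  finite_hom : ∀ d d' : D, Finite (d ⟶ d')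
  finite_values : ∀ d : D, Finite (W.obj d)

end Weighted

/-- All weak limits with finite weights exist. -/
def WeaklyLex (C : Type u) [Category.{v} C] [PosEnriched C] : Prop :=
  ∀ (D : Type) [Category.{0} D] [PosEnriched D] (W : PosFunctor D PartOrd.{0})
    (F : PosFunctor D C), W.IsFiniteWeight →
      ∃ (L : C) (c : WeightedCone W F L), c.IsWeakLimit

/-- All limits with finite weights exist. -/
def FinitelyComplete (C : Type u) [Category.{v} C] [PosEnriched C] : Prop :=
  ∀ (D : Type) [Category.{0} D] [PosEnriched D] (W : PosFunctor D PartOrd.{0})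
    (F : PosFunctor D C), W.IsFiniteWeight →
      ∃ (L : C) (c : WeightedCone W F L), c.IsLimit

section Notions

variable {C : Type u} [Category.{v} C] [PosEnriched C]

/-! ### Particular limits and colimits -/

/-- A weak pullback square of `f : X ⟶ Z` and `g : Y ⟶ Z`. -/
def IsWeakPullbackSq {P X Y Z : C} (p : P ⟶ X) (q : P ⟶ Y) (f : X ⟶ Z) (g : Y ⟶ Z) : Prop :=
  p ≫ f = q ≫ g ∧
    ∀ (A : C) (a : A ⟶ X) (b : A ⟶ Y), a ≫ f = b ≫ g → ∃ h : A ⟶ P, h ≫ p = a ∧ h ≫ q = b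

/-- A (poset-enriched) pullback square: the legs are moreover jointly order-monic. -/
def IsPullbackSq {P X Y Z : C} (p : P ⟶ X) (q : P ⟶ Y) (f : X ⟶ Z) (g : Y ⟶ Z) : Prop :=
  IsWeakPullbackSq p q f g ∧
    ∀ (A : C) (h h' : A ⟶ P), h ≫ p ≤ h' ≫ p → h ≫ q ≤ h' ≫ q → h ≤ h'

/-- A weak comma square of the ordered pair `(f : X ⟶ Z, g : Y ⟶ Z)`. -/
def IsWeakCommaSq {P X Y Z : C} (p : P ⟶ X) (q : P ⟶ Y) (f : X ⟶ Z) (g : Y ⟶ Z) : Prop :=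
  p ≫ f ≤ q ≫ g ∧
    ∀ (A : C) (a : A ⟶ X) (b : A ⟶ Y), a ≫ f ≤ b ≫ g → ∃ h : A ⟶ P, h ≫ p = a ∧ h ≫ q = b

/-- `q` is the coinserter of the ordered pair `(f, g)`. -/
def IsCoinserter {X Y Q : C} (f g : X ⟶ Y) (q : Y ⟶ Q) : Prop :=
  f ≫ q ≤ g ≫ q ∧
    (∀ (Z : C) (h : Y ⟶ Z), f ≫ h ≤ g ≫ h → ∃ k : Q ⟶ Z, q ≫ k = h) ∧
    ∀ (Z : C) (k k' : Q ⟶ Z), q ≫ k ≤ q ≫ k' → k ≤ k'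

/-! ### Regularity and projectives -/

/-- Order-monomorphisms (`ff`-morphisms): post-composition reflects the order. -/
def IsOrderMono {X Y : C} (m : X ⟶ Y) : Prop :=
  ∀ (Z : C) (f g : Z ⟶ X), f ≫ m ≤ g ≫ m → f ≤ g

/-- `so`-morphisms: for each order-monomorphism `m : X ⟶ Y`, the map
`C(B, X) ⟶ C(A, X) ×_{C(A, Y)} C(B, Y)`, `w ↦ (e ≫ w, w ≫ m)`, is an isomorphism of posets. -/
def IsSo {A B : C} (e : A ⟶ B) : Prop :=
  ∀ (X Y : C) (m : X ⟶ Y), IsOrderMono m →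
    (∀ (a : A ⟶ X) (b : B ⟶ Y), a ≫ m = e ≫ b → ∃ w : B ⟶ X, e ≫ w = a ∧ w ≫ m = b) ∧
    ∀ w w' : B ⟶ X, e ≫ w ≤ e ≫ w' → w ≫ m ≤ w' ≫ m → w ≤ w'

variable (C) in
/-- Regular poset-enriched categories. -/
structure IsRegularPos : Prop where
  finitelyComplete : FinitelyComplete C
  factorization : ∀ {X Y : C} (f : X ⟶ Y), ∃ (Z : C) (e : X ⟶ Z) (m : Z ⟶ Y),
    IsSo e ∧ IsOrderMono m ∧ e ≫ m = f
  so_stable : ∀ {P X Y Z : C} (p : P ⟶ X) (q : P ⟶ Y) (f : X ⟶ Z) (g : Y ⟶ Z),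
    IsPullbackSq p q f g → IsSo f → IsSo q

/-- `P` is `so`-projective: `C(P, -)` sends `so`-morphisms to surjections. -/
def IsSoProjective (P : C) : Prop :=
  ∀ (X Y : C) (e : X ⟶ Y), IsSo e → Function.Surjective (fun g : P ⟶ X => g ≫ e)

/-- The full subcategory on the objects with the property `P` is a projective cover of the regular
category `C`. -/
structure IsProjectiveCover (P : ObjectProperty C) : Prop where
  regular : IsRegularPos C
  projective : ∀ X : C, P X → IsSoProjective X
  cover : ∀ X : C, ∃ (Y : C) (e : Y ⟶ X), P Y ∧ IsSo e

/-- Fully order-faithful functors: those inducing isomorphisms on hom-posets. -/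
def PosFunctor.IsFullyOrderFaithful {D : Type u'} [Category.{v'} D] [PosEnriched D]
    (F : PosFunctor C D) : Prop :=
  ∀ X Y : C, Function.Surjective (fun f : X ⟶ Y => F.map f) ∧
    ∀ f g : X ⟶ Y, F.map f ≤ F.map g ↔ f ≤ g

end Notions

/-! ### The exact completion -/

/-- Pseudocongruences in `C`: parallel pairs `r₀, r₁ : R ⟶ X` which are order-reflexive and
transitive. These are the objects `(X, R)` of the exact completion. -/
structure ExCompletion (C : Type u) [Category.{v} C] [PosEnriched C] where
  X : C
  R : C
  r₀ : R ⟶ X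
  r₁ : R ⟶ X
  order_reflexive : ∀ (A : C) (a₀ a₁ : A ⟶ X), a₀ ≤ a₁ →
    ∃ h : A ⟶ R, h ≫ r₀ = a₀ ∧ h ≫ r₁ = a₁
  transitive : ∃ (RR : C) (d₀ d₁ : RR ⟶ R), IsWeakPullbackSq d₀ d₁ r₁ r₀ ∧
    ∃ τ : RR ⟶ R, τ ≫ r₀ = d₀ ≫ r₀ ∧ τ ≫ r₁ = d₁ ≫ r₁

namespace ExCompletion

section

variable {C : Type u} [Category.{v} C] [PosEnriched C]

/-- Representatives of morphisms `(X, R) ⟶ (Y, S)`: morphisms `f : X ⟶ Y` of `C` which are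
compatible with the pseudocongruences. -/
structure PreHom (A B : ExCompletion C) where
  f : A.X ⟶ B.X
  compat : ∃ fbar : A.R ⟶ B.R, fbar ≫ B.r₀ = A.r₀ ≫ f ∧ fbar ≫ B.r₁ = A.r₁ ≫ f

/-- The preorder on representatives: `f ≼ g` if `(f, g)` factors through `(s₀, s₁)`. -/
instance preHomPreorder (A B : ExCompletion C) : Preorder (PreHom A B) where
  le f g := ∃ σ : A.X ⟶ B.R, σ ≫ B.r₀ = f.f ∧ σ ≫ B.r₁ = g.f
  le_refl f := B.order_reflexive _ _ _ le_rfl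
  le_trans f g h := by
    rintro ⟨σ, hσ₀, hσ₁⟩ ⟨σ', hσ'₀, hσ'₁⟩
    obtain ⟨RR, d₀, d₁, ⟨-, hP⟩, τ, hτ₀, hτ₁⟩ := B.transitive
    obtain ⟨k, hk₀, hk₁⟩ := hP _ σ σ' (hσ₁.trans hσ'₀.symm)
    refine ⟨k ≫ τ, ?_, ?_⟩
    · rw [Category.assoc, hτ₀, ← Category.assoc, hk₀, hσ₀]
    · rw [Category.assoc, hτ₁, ← Category.assoc, hk₁, hσ'₁]

namespace PreHom

theorem le_def {A B : ExCompletion C} (f g : PreHom A B) :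
    f ≤ g ↔ ∃ σ : A.X ⟶ B.R, σ ≫ B.r₀ = f.f ∧ σ ≫ B.r₁ = g.f := Iff.rfl

/-- The identity representative. -/
def id (A : ExCompletion C) : PreHom A A := ⟨𝟙 _, 𝟙 _, by simp, by simp⟩

/-- Composition of representatives. -/
def comp {A B E : ExCompletion C} (f : PreHom A B) (g : PreHom B E) : PreHom A E where
  f := f.f ≫ g.f
  compat := by
    obtain ⟨a, ha₀, ha₁⟩ := f.compat
    obtain ⟨b, hb₀, hb₁⟩ := g.compat
    refine ⟨a ≫ b, ?_, ?_⟩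
    · rw [Category.assoc, hb₀, ← Category.assoc, ha₀, Category.assoc]
    · rw [Category.assoc, hb₁, ← Category.assoc, ha₁, Category.assoc]

theorem comp_le_comp {A B E : ExCompletion C} {f f' : PreHom A B} {g g' : PreHom B E}
    (hf : f ≤ f') (hg : g ≤ g') : f.comp g ≤ f'.comp g' := by
  obtain ⟨σ, hσ₀, hσ₁⟩ := hf
  obtain ⟨σ', hσ'₀, hσ'₁⟩ := hg
  obtain ⟨b, hb₀, hb₁⟩ := g.compat
  refine le_trans (b := f'.comp g) ⟨σ ≫ b, ?_, ?_⟩ ⟨f'.f ≫ σ', ?_, ?_⟩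
  · rw [Category.assoc, hb₀, ← Category.assoc, hσ₀]; rfl
  · rw [Category.assoc, hb₁, ← Category.assoc, hσ₁]; rfl
  · rw [Category.assoc, hσ'₀]; rfl
  · rw [Category.assoc, hσ'₁]; rfl

end PreHom

/-- The exact completion: morphisms are classes of representatives modulo the equivalence relation
induced by the preorder. -/
instance category : Category.{v} (ExCompletion C) where
  Hom A B := Antisymmetrization (PreHom A B) (· ≤ ·)
  id A := toAntisymmetrization _ (PreHom.id A)
  comp := Quotient.map₂ PreHom.comp (fun _ _ hf _ _ hg =>
    ⟨PreHom.comp_le_comp hf.1 hg.1, PreHom.comp_le_comp hf.2 hg.2⟩)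
  id_comp := by
    rintro A B ⟨f⟩
    exact congrArg (toAntisymmetrization (· ≤ ·))
      (show (PreHom.id A).comp f = f by simp [PreHom.id, PreHom.comp])
  comp_id := by
    rintro A B ⟨f⟩
    exact congrArg (toAntisymmetrization (· ≤ ·))
      (show f.comp (PreHom.id B) = f by simp [PreHom.id, PreHom.comp])
  assoc := by
    rintro A B E F ⟨f⟩ ⟨g⟩ ⟨h⟩
    exact congrArg (toAntisymmetrization (· ≤ ·))
      (show (f.comp g).comp h = f.comp (g.comp h) by simp [PreHom.comp])

/-- The class `[f]` of a representative. -/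
def homMk {A B : ExCompletion C} (f : PreHom A B) : A ⟶ B := toAntisymmetrization (· ≤ ·) f

instance posEnriched : PosEnriched (ExCompletion C) where
  homOrder A B := inferInstanceAs (PartialOrder (Antisymmetrization (PreHom A B) (· ≤ ·)))
  comp_mono := by
    rintro A B E ⟨f⟩ ⟨f'⟩ ⟨g⟩ ⟨g'⟩ hf hg
    exact PreHom.comp_le_comp (f := f) (f' := f') (g := g) (g' := g') hf hg

theorem homMk_le_homMk {A B : ExCompletion C} (f g : PreHom A B) :
    homMk f ≤ homMk g ↔ f ≤ g := Iff.rfl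

end

end ExCompletion

/-! ### The embedding of a weakly lex category into its exact completion -/

/-- The discrete poset-enrichment of an ordinary category. -/
abbrev discretePosEnriched (D : Type u) [Category.{v} D] : PosEnriched D where
  homOrder X Y :=
    { le := fun f g => f = g
      le_refl := fun _ => rfl
      le_trans := fun _ _ _ h h' => h.trans h'
      le_antisymm := fun _ _ h _ => h }
  comp_mono := by
    rintro X Y Z f _ g _ rfl rfl
    rfl

section Embedding

variable {C : Type u} [Category.{v} C] [PosEnriched C]

theorem WeaklyLex.exists_weakPullback (hC : WeaklyLex C) {X Y Z : C} (f : X ⟶ Z) (g : Y ⟶ Z) :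
    ∃ (P : C) (p : P ⟶ X) (q : P ⟶ Y), IsWeakPullbackSq p q f g := by
  let _ : PosEnriched Limits.WalkingCospan := discretePosEnriched _
  let W : PosFunctor Limits.WalkingCospan PartOrd.{0} :=
    { (Functor.const Limits.WalkingCospan).obj (PartOrd.of PUnit.{1}) with
      map_mono := by
        intro _ _ _ _ _
        exact le_rfl }
  let F : PosFunctor Limits.WalkingCospan C :=
    { Limits.cospan f g with
      map_mono := by
        rintro _ _ a _ rfl
        exact le_rfl }
  have hW : W.IsFiniteWeight :=
    ⟨⟨Set.univ, Set.toFinite _, fun d => ⟨d, trivial, ⟨Iso.refl d⟩⟩⟩,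
      fun d d' => inferInstance, fun d => inferInstanceAs (Finite PUnit)⟩
  obtain ⟨P, c, hc⟩ := hC _ W F hW
  have hl : c.app .one PUnit.unit = c.app .left PUnit.unit ≫ f :=
    c.naturality Limits.WalkingCospan.Hom.inl PUnit.unit
  have hr : c.app .one PUnit.unit = c.app .right PUnit.unit ≫ g :=
    c.naturality Limits.WalkingCospan.Hom.inr PUnit.unit
  refine ⟨P, c.app .left PUnit.unit, c.app .right PUnit.unit, hl.symm.trans hr, ?_⟩
  intro A a b hab
  let c' : WeightedCone W F A :=
    { app := fun d _ => match d with
        | .left => a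
        | .right => b
        | .one => a ≫ f
      mono := fun d _ _ _ => le_rfl
      naturality := by
        rintro _ _ (_ | _ | _) x
        · exact (F.map_id _ ▸ (Category.comp_id _).symm)
        · rfl
        · exact hab }
  obtain ⟨h, hh⟩ := hc A c'
  refine ⟨h, ?_, ?_⟩
  · exact congrFun (congrFun (congrArg WeightedCone.app hh) .left) PUnit.unit
  · exact congrFun (congrFun (congrArg WeightedCone.app hh) .right) PUnit.unit

variable (C) in
/-- A choice, for every object `X`, of a weak comma square of `(𝟙 X, 𝟙 X)`. -/
structure WeakCommaChoice where
  obj : C → C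
  i₀ : ∀ X : C, obj X ⟶ X
  i₁ : ∀ X : C, obj X ⟶ X
  isWeakComma : ∀ X : C, IsWeakCommaSq (i₀ X) (i₁ X) (𝟙 X) (𝟙 X)

namespace WeakCommaChoice

theorem le (I : WeakCommaChoice C) (X : C) : I.i₀ X ≤ I.i₁ X := by
  simpa using (I.isWeakComma X).1

theorem factor (I : WeakCommaChoice C) {X A : C} {a₀ a₁ : A ⟶ X} (h : a₀ ≤ a₁) :
    ∃ k : A ⟶ I.obj X, k ≫ I.i₀ X = a₀ ∧ k ≫ I.i₁ X = a₁ :=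
  (I.isWeakComma X).2 A a₀ a₁ (by simpa using h)

/-- The object `Γ X = (X, I_X)`. -/
def gammaObj (hC : WeaklyLex C) (I : WeakCommaChoice C) (X : C) : ExCompletion C where
  X := X
  R := I.obj X
  r₀ := I.i₀ X
  r₁ := I.i₁ X
  order_reflexive _ _ _ h := I.factor h
  transitive := by
    obtain ⟨P, p, q, hP⟩ := hC.exists_weakPullback (I.i₁ X) (I.i₀ X)
    refine ⟨P, p, q, hP, I.factor ?_⟩
    calc p ≫ I.i₀ X ≤ p ≫ I.i₁ X := PosEnriched.comp_mono le_rfl (I.le X)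
      _ = q ≫ I.i₀ X := hP.1
      _ ≤ q ≫ I.i₁ X := PosEnriched.comp_mono le_rfl (I.le X)

/-- Any `f : X ⟶ Y` in `C` represents a morphism `(X, I_X) ⟶ (Y, S)`. -/
def preHom (hC : WeaklyLex C) (I : WeakCommaChoice C) {X : C} (B : ExCompletion C)
    (f : X ⟶ B.X) : ExCompletion.PreHom (I.gammaObj hC X) B where
  f := f
  compat := B.order_reflexive _ _ _ (PosEnriched.comp_mono (I.le X) le_rfl)

/-- The functor `Γ : C ⟶ C_ex`, `X ↦ (X, I_X)`, `f ↦ [f]`. -/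
def gamma (hC : WeaklyLex C) (I : WeakCommaChoice C) : PosFunctor C (ExCompletion C) where
  obj X := I.gammaObj hC X
  map {_ Y} f := ExCompletion.homMk (I.preHom hC (I.gammaObj hC Y) f)
  map_id _ := rfl
  map_comp _ _ := rfl
  map_mono h := I.factor h

/-- The morphism `[1_X] : Γ X ⟶ (X, R)`. -/
def proj (hC : WeaklyLex C) (I : WeakCommaChoice C) (A : ExCompletion C) :
    (I.gamma hC).obj A.X ⟶ A :=
  ExCompletion.homMk (I.preHom hC A (𝟙 A.X))

end WeakCommaChoice

end Embedding

/-! Any arrow `X ⟶ B.X` represents a morphism `Γ X ⟶ B`, and such morphisms are compared by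
factoring pairs through `B.r₀, B.r₁`. Hence the condition for a map on `Γ X` to coinsert `Γ r₀, Γ
r₁` is literally compatibility of its representative. This gives `isCoinserter_proj`, and
coinserters are `so`-morphisms.

The other tool is `exists_inverseImage`: weak limits suffice to pull pseudocongruences back along
arrows of `C`, since only existence of factorizations matters. Inverse images make maps order-monic
by construction. Applied to a weak limit of representatives and witnesses, they give finite limits
(`exists_universal_solution`); applied to one representative `f`, they give the factorization of
`[f]`, whose first factor is represented by an identity, so that maps from `Γ X` lift along it.

If `[f]` is an `so`-morphism, its order-monic part has a section, so maps from `Γ X` lift along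
`[f]` too: `Γ X` is projective. Pullback stability then follows by lifting canonical covers. -/

/-! ### Weak limits in a weakly lex category -/

/-- The code of an arrow of a walking multicospan. -/
def CategoryTheory.Limits.WalkingMulticospan.Hom.code {J : Limits.MulticospanShape.{0, 0}} :
    ∀ {a b : Limits.WalkingMulticospan J}, Limits.WalkingMulticospan.Hom a b → Option (J.R × Bool)
  | _, _, .id _ => none
  | _, _, .fst r => some (r, false)
  | _, _, .snd r => some (r, true)

/-- Independent endpoints allow case analysis on both arrows. Only identities need `ha`; other codes
determine both endpoints. -/
theorem CategoryTheory.Limits.WalkingMulticospan.Hom.heq_of_code_eq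
    {J : Limits.MulticospanShape.{0, 0}} {a b a' b' : Limits.WalkingMulticospan J}
    (f : Limits.WalkingMulticospan.Hom a b) (g : Limits.WalkingMulticospan.Hom a' b')
    (ha : a = a') (h : f.code = g.code) : HEq f g := by
  cases f <;> cases g <;> simp only [code, Option.some.injEq, Prod.mk.injEq, reduceCtorEq,
    Bool.false_eq_true, Bool.true_eq_false, and_false, and_true] at h
  · subst ha; rfl
  · subst h; rfl
  · subst h; rfl

instance CategoryTheory.Limits.WalkingMulticospan.finite_hom
    {J : Limits.MulticospanShape.{0, 0}} [Finite J.R] (a b : Limits.WalkingMulticospan J) :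
    Finite (a ⟶ b) :=
  Finite.of_injective (fun f : Limits.WalkingMulticospan.Hom a b => f.code)
    (fun f g h => eq_of_heq (f.heq_of_code_eq g rfl h))

instance CategoryTheory.Limits.WalkingMulticospan.finite
    {J : Limits.MulticospanShape.{0, 0}} [Finite J.L] [Finite J.R] :
    Finite (Limits.WalkingMulticospan J) :=
  Finite.of_surjective (Sum.elim Limits.WalkingMulticospan.left Limits.WalkingMulticospan.right)
    (by rintro (i | r); exacts [⟨.inl i, rfl⟩, ⟨.inr r, rfl⟩])

section WeakLimits

variable {C : Type u} [Category.{v} C] [PosEnriched C]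

/-- A weakly lex category has weak multiequalizers of finite shape. -/
theorem WeaklyLex.exists_weakMultiequalizer (hC : WeaklyLex C)
    {J : Limits.MulticospanShape.{0, 0}} [Finite J.L] [Finite J.R]
    (M : Limits.MulticospanIndex J C) :
    ∃ (P : C) (l : ∀ i, P ⟶ M.left i),
      (∀ r, l (J.fst r) ≫ M.fst r = l (J.snd r) ≫ M.snd r) ∧
      ∀ (A : C) (a : ∀ i, A ⟶ M.left i),
        (∀ r, a (J.fst r) ≫ M.fst r = a (J.snd r) ≫ M.snd r) →
        ∃ h : A ⟶ P, ∀ i, h ≫ l i = a i := by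
  let _ : PosEnriched (Limits.WalkingMulticospan J) := discretePosEnriched _
  let W : PosFunctor (Limits.WalkingMulticospan J) PartOrd.{0} :=
    { (Functor.const (Limits.WalkingMulticospan J)).obj (PartOrd.of PUnit.{1}) with
      map_mono := fun _ => le_rfl }
  let F : PosFunctor (Limits.WalkingMulticospan J) C :=
    { M.multicospan with
      map_mono := by
        rintro _ _ a _ rfl
        exact le_rfl }
  have hW : W.IsFiniteWeight :=
    ⟨⟨Set.univ, Set.toFinite _, fun d => ⟨d, trivial, ⟨Iso.refl d⟩⟩⟩,
      fun d d' => inferInstance, fun d => inferInstanceAs (Finite PUnit)⟩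
  obtain ⟨P, c, hc⟩ := hC _ W F hW
  have hl (r) : c.app (.right r) PUnit.unit = c.app (.left (J.fst r)) PUnit.unit ≫ M.fst r :=
    c.naturality (Limits.WalkingMulticospan.Hom.fst r) PUnit.unit
  have hr (r) : c.app (.right r) PUnit.unit = c.app (.left (J.snd r)) PUnit.unit ≫ M.snd r :=
    c.naturality (Limits.WalkingMulticospan.Hom.snd r) PUnit.unit
  refine ⟨P, fun i => c.app (.left i) PUnit.unit, fun r => (hl r).symm.trans (hr r), ?_⟩
  intro A a ha
  let c' : WeightedCone W F A :=
    { app := fun d _ => match d with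
        | .left i => a i
        | .right r => a (J.fst r) ≫ M.fst r
      mono := fun d _ _ _ => le_rfl
      naturality := by
        rintro _ _ (_ | r | r) x
        · exact (F.map_id _ ▸ (Category.comp_id _).symm)
        · rfl
        · exact ha r }
  obtain ⟨h, hh⟩ := hc A c'
  exact ⟨h, fun i => congrFun (congrFun (congrArg WeightedCone.app hh) (.left i)) PUnit.unit⟩

/-- A weakly lex category has weak comma squares of identities. -/
theorem WeaklyLex.exists_weakComma_id (hC : WeaklyLex C) (X : C) :
    ∃ (P : C) (p q : P ⟶ X), IsWeakCommaSq p q (𝟙 X) (𝟙 X) := by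
  let _ : PosEnriched (Discrete PUnit.{1}) := discretePosEnriched _
  -- A cone weighted by the two-element chain `false ≤ true` is an ordered pair of parallel arrows.
  let W : PosFunctor (Discrete PUnit.{1}) PartOrd.{0} :=
    { (Functor.const (Discrete PUnit.{1})).obj (PartOrd.of Bool) with
      map_mono := fun _ => le_rfl }
  let F : PosFunctor (Discrete PUnit.{1}) C :=
    { (Functor.const (Discrete PUnit.{1})).obj X with
      map_mono := fun _ => le_rfl }
  have hW : W.IsFiniteWeight :=
    ⟨⟨Set.univ, Set.toFinite _, fun d => ⟨d, trivial, ⟨Iso.refl d⟩⟩⟩,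
      fun d d' => inferInstance, fun d => inferInstanceAs (Finite Bool)⟩
  obtain ⟨P, c, hc⟩ := hC _ W F hW
  refine ⟨P, c.app ⟨⟨⟩⟩ false, c.app ⟨⟨⟩⟩ true, ?_, ?_⟩
  · rw [Category.comp_id, Category.comp_id]
    exact c.mono ⟨⟨⟩⟩ (show (false : Bool) ≤ true from Bool.false_le _)
  · intro A a b hab
    rw [Category.comp_id, Category.comp_id] at hab
    let c' : WeightedCone W F A :=
      { app := fun _ (x : Bool) => cond x b a
        mono := by
          rintro d (_ | _) (_ | _) h
          exacts [le_rfl, hab, absurd (show (true : Bool) ≤ false from h) (by decide), le_rfl]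
        naturality := fun _ _ => (Category.comp_id _).symm }
    obtain ⟨h, hh⟩ := hc A c'
    exact ⟨h, congrFun (congrFun (congrArg WeightedCone.app hh) ⟨⟨⟩⟩) false,
      congrFun (congrFun (congrArg WeightedCone.app hh) ⟨⟨⟩⟩) true⟩

theorem WeaklyLex.nonempty_weakCommaChoice (hC : WeaklyLex C) : Nonempty (WeakCommaChoice C) := by
  choose P p q h using hC.exists_weakComma_id
  exact ⟨⟨P, p, q, h⟩⟩

end WeakLimits

/-! ### Inverse images of families of pseudocongruences -/

namespace ExCompletion

section InverseImage

variable {C : Type u} [Category.{v} C] [PosEnriched C]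

theorem homMk_surjective {A B : ExCompletion C} (φ : A ⟶ B) :
    ∃ f : PreHom A B, homMk f = φ :=
  Quotient.exists_rep φ

theorem homMk_ext {A B : ExCompletion C} {f g : PreHom A B} (h : f.f = g.f) :
    homMk f = homMk g := by
  cases f
  cases h
  rfl

/-- Along a finite family of morphisms `l i : X ⟶ (Y i).X`, the pseudocongruences of the `Y i` have
a joint inverse image: a pseudocongruence `(r₀, r₁)` on `X` such that a pair into `X` factors
through it if and only if all its images factor through the pseudocongruences of the `Y i`. -/
theorem exists_inverseImage (hC : WeaklyLex C) {ι : Type} [Finite ι] {X : C}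
    (Y : ι → ExCompletion C) (l : ∀ i, X ⟶ (Y i).X) :
    ∃ (R : C) (r₀ r₁ : R ⟶ X),
      (∃ (P : C) (d₀ d₁ : P ⟶ R), IsWeakPullbackSq d₀ d₁ r₁ r₀ ∧
        ∃ τ : P ⟶ R, τ ≫ r₀ = d₀ ≫ r₀ ∧ τ ≫ r₁ = d₁ ≫ r₁) ∧
      (∀ (A : C) (p q : A ⟶ X), p ≤ q → ∃ h : A ⟶ R, h ≫ r₀ = p ∧ h ≫ r₁ = q) ∧
      ∀ (A : C) (p q : A ⟶ X), (∃ h : A ⟶ R, h ≫ r₀ = p ∧ h ≫ r₁ = q) ↔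
        ∀ i, ∃ h : A ⟶ (Y i).R, h ≫ (Y i).r₀ = p ≫ l i ∧ h ≫ (Y i).r₁ = q ≫ l i := by
  -- The unknowns are the two legs into `X` and, for each `i`, a witness in `(Y i).R`; two equations
  -- per `i` fix the ends of the witness.
  let J : Limits.MulticospanShape.{0, 0} :=
    { L := Bool ⊕ ι
      R := ι × Bool
      fst := fun k => .inr k.1
      snd := fun k => .inl k.2 }
  let M : Limits.MulticospanIndex J C :=
    { left := fun i => match i with
        | .inl _ => X
        | .inr i => (Y i).R
      right := fun k => (Y k.1).X
      fst := fun k => match k with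
        | (i, false) => (Y i).r₀
        | (i, true) => (Y i).r₁
      snd := fun k => l k.1 }
  have : Finite J.L := inferInstanceAs (Finite (Bool ⊕ ι))
  have : Finite J.R := inferInstanceAs (Finite (ι × Bool))
  obtain ⟨R, m, hm, hR⟩ := hC.exists_weakMultiequalizer M
  let r₀ : R ⟶ X := m (.inl false)
  let r₁ : R ⟶ X := m (.inl true)
  let ρ : ∀ i, R ⟶ (Y i).R := fun i => m (.inr i)
  have hρ₀ (i) : ρ i ≫ (Y i).r₀ = r₀ ≫ l i := hm (i, false)
  have hρ₁ (i) : ρ i ≫ (Y i).r₁ = r₁ ≫ l i := hm (i, true)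
  have key (A : C) (p q : A ⟶ X) : (∃ h : A ⟶ R, h ≫ r₀ = p ∧ h ≫ r₁ = q) ↔
      ∀ i, ∃ h : A ⟶ (Y i).R, h ≫ (Y i).r₀ = p ≫ l i ∧ h ≫ (Y i).r₁ = q ≫ l i := by
    constructor
    · rintro ⟨h, rfl, rfl⟩ i
      exact ⟨h ≫ ρ i, by simp only [Category.assoc, hρ₀], by simp only [Category.assoc, hρ₁]⟩
    · intro H
      choose σ hσ₀ hσ₁ using H
      obtain ⟨h, hh⟩ := hR A
        (fun i => match i with
          | .inl false => p
          | .inl true => q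
          | .inr i => σ i)
        (by
          rintro ⟨i, _ | _⟩
          exacts [hσ₀ i, hσ₁ i])
      exact ⟨h, hh (.inl false), hh (.inl true)⟩
  obtain ⟨P, d₀, d₁, hP⟩ := hC.exists_weakPullback r₁ r₀
  have htrans : ∃ τ : P ⟶ R, τ ≫ r₀ = d₀ ≫ r₀ ∧ τ ≫ r₁ = d₁ ≫ r₁ := by
    -- By `key`, transitivity can be checked in each `Y i`, where the two witnesses compose.
    refine (key P _ _).2 fun i => ?_
    obtain ⟨Q, e₀, e₁, hQ, τ, hτ₀, hτ₁⟩ := (Y i).transitive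
    obtain ⟨k, hk₀, hk₁⟩ := hQ.2 P (d₀ ≫ ρ i) (d₁ ≫ ρ i) (by
      rw [Category.assoc, hρ₁, Category.assoc, hρ₀, ← Category.assoc, hP.1, Category.assoc])
    refine ⟨k ≫ τ, ?_, ?_⟩
    · rw [Category.assoc, hτ₀, ← Category.assoc, hk₀, Category.assoc, hρ₀, Category.assoc]
    · rw [Category.assoc, hτ₁, ← Category.assoc, hk₁, Category.assoc, hρ₁, Category.assoc]
  exact ⟨R, r₀, r₁, ⟨P, d₀, d₁, hP, htrans⟩, fun A a₀ a₁ h => (key A a₀ a₁).2 fun i =>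
    (Y i).order_reflexive A _ _ (PosEnriched.comp_mono h le_rfl), key⟩

end InverseImage

/-! ### Finite limits in the exact completion -/

/-- A formal inequality `x_s ≫ φ ≤ x_t ≫ ψ` between variables `x_i` with values in morphisms into
`Y i`. -/
structure FormalInequality {E : Type u} [Category.{v} E] {ι : Type} (Y : ι → E) where
  s : ι
  t : ι
  Z : E
  φ : Y s ⟶ Z
  ψ : Y t ⟶ Z

/-- The family `a` satisfies the formal inequality. -/
def FormalInequality.Holds {E : Type u} [Category.{v} E] [PosEnriched E] {ι : Type} {Y : ι → E}
    (q : FormalInequality Y) {A : E} (a : ∀ i, A ⟶ Y i) : Prop :=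
  a q.s ≫ q.φ ≤ a q.t ≫ q.ψ

section FiniteLimits

variable {C : Type u} [Category.{v} C] [PosEnriched C]

/-- Finite systems of inequalities have a universal solution in the exact completion. -/
theorem exists_universal_solution (hC : WeaklyLex C) {ι κ : Type} [Finite ι] [Finite κ]
    (Y : ι → ExCompletion C) (q : κ → FormalInequality Y) :
    ∃ (L : ExCompletion C) (l : ∀ i, L ⟶ Y i), (∀ k, (q k).Holds l) ∧
      (∀ (A : ExCompletion C) (a : ∀ i, A ⟶ Y i), (∀ k, (q k).Holds a) →
        ∃ h : A ⟶ L, ∀ i, h ≫ l i = a i) ∧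
      ∀ (A : ExCompletion C) (h h' : A ⟶ L), (∀ i, h ≫ l i ≤ h' ≫ l i) → h ≤ h' := by
  choose f hf using fun k => homMk_surjective (q k).φ
  choose g hg using fun k => homMk_surjective (q k).ψ
  -- In `C` an inequality becomes extra data: the unknowns are the representatives of the `l i` and
  -- one witness in `(q k).Z.R` for each `k`.
  let J : Limits.MulticospanShape.{0, 0} :=
    { L := ι ⊕ κ
      R := κ × Bool
      fst := fun k => .inr k.1
      snd := fun k => .inl (cond k.2 (q k.1).t (q k.1).s) }
  let M : Limits.MulticospanIndex J C :=
    { left := fun i => match i with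
        | .inl i => (Y i).X
        | .inr k => (q k).Z.R
      right := fun k => (q k.1).Z.X
      fst := fun k => match k with
        | (k, false) => (q k).Z.r₀
        | (k, true) => (q k).Z.r₁
      snd := fun k => match k with
        | (k, false) => (f k).f
        | (k, true) => (g k).f }
  have : Finite J.L := inferInstanceAs (Finite (ι ⊕ κ))
  have : Finite J.R := inferInstanceAs (Finite (κ × Bool))
  obtain ⟨X, m, hm, hX⟩ := hC.exists_weakMultiequalizer M
  -- The inverse image ignores the witnesses, so the order on maps into `L` is tested by the `l i`
  -- alone.
  obtain ⟨R, r₀, r₁, ht, hr, hL⟩ := exists_inverseImage hC Y (fun i => m (.inl i))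
  let L : ExCompletion C := ⟨X, R, r₀, r₁, hr, ht⟩
  let l : ∀ i, PreHom L (Y i) := fun i =>
    ⟨m (.inl i), (hL R r₀ r₁).1 ⟨𝟙 _, by simp, by simp⟩ i⟩
  refine ⟨L, fun i => homMk (l i), ?_, ?_, ?_⟩
  · intro k
    rw [FormalInequality.Holds, ← hf, ← hg]
    exact ⟨m (.inr k), hm (k, false), hm (k, true)⟩
  · intro A a ha
    choose b hb using fun i => homMk_surjective (a i)
    obtain rfl : (fun i => homMk (b i)) = a := funext hb
    have hσ (k) : ∃ σ : A.X ⟶ (q k).Z.R, σ ≫ (q k).Z.r₀ = (b (q k).s).f ≫ (f k).f ∧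
        σ ≫ (q k).Z.r₁ = (b (q k).t).f ≫ (g k).f := by
      have := ha k
      rw [FormalInequality.Holds, ← hf, ← hg] at this
      exact this
    choose σ hσ₀ hσ₁ using hσ
    obtain ⟨h, hh⟩ := hX A.X
      (fun i => match i with
        | .inl i => (b i).f
        | .inr k => σ k)
      (by
        rintro ⟨k, _ | _⟩
        exacts [hσ₀ k, hσ₁ k])
    have hh' (i) : h ≫ m (.inl i) = (b i).f := hh (.inl i)
    refine ⟨homMk ⟨h, (hL A.R (A.r₀ ≫ h) (A.r₁ ≫ h)).2 fun i => ?_⟩, fun i => ?_⟩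
    · simpa only [Category.assoc, hh'] using (b i).compat
    · exact homMk_ext (hh' i)
  · intro A h h' H
    obtain ⟨h, rfl⟩ := homMk_surjective h
    obtain ⟨h', rfl⟩ := homMk_surjective h'
    exact (hL A.X h.f h'.f).2 H

/-- The exact completion has all finite weighted limits. -/
theorem finitelyComplete (hC : WeaklyLex C) : FinitelyComplete (ExCompletion C) := by
  intro D _ _ W F hW
  obtain ⟨s, hs, hsD⟩ := hW.finite_objects
  have := hW.finite_hom
  have := hW.finite_values
  have : Finite s := hs
  choose rep hrep e using hsD
  replace e (d) : d ≅ rep d := (e d).some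
  let ι : Type := Σ d : s, W.obj d.1
  let Y : ι → ExCompletion C := fun i => F.obj i.1.1
  -- Cones over the finitely many objects in `s` are solutions of these inequalities: `y = W.map g
  -- x` in both families gives naturality, and `g = 𝟙` in the first gives monotonicity.
  let κ : Type := Σ (d d' : s) (g : d.1 ⟶ d'.1) (x : W.obj d.1),
    { y : W.obj d'.1 // W.map g x ≤ y }
  let κ' : Type := Σ (d d' : s) (g : d.1 ⟶ d'.1) (x : W.obj d.1),
    { y : W.obj d'.1 // y ≤ W.map g x }
  let q : κ ⊕ κ' → FormalInequality Y := Sum.elim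
    (fun ⟨d, d', g, x, y, _⟩ => ⟨⟨d, x⟩, ⟨d', y⟩, F.obj d'.1, F.map g, 𝟙 _⟩)
    (fun ⟨d, d', g, x, y, _⟩ => ⟨⟨d', y⟩, ⟨d, x⟩, F.obj d'.1, 𝟙 _, F.map g⟩)
  obtain ⟨L, l, hl, hex, hmono⟩ := exists_universal_solution hC Y q
  let a (d : D) (hd : d ∈ s) (x : W.obj d) : L ⟶ F.obj d := l ⟨⟨d, hd⟩, x⟩
  have ha (d d' : D) (hd : d ∈ s) (hd' : d' ∈ s) (g : d ⟶ d') (x : W.obj d) (y : W.obj d')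
      (hxy : W.map g x ≤ y) : a d hd x ≫ F.map g ≤ a d' hd' y := by
    exact (hl (.inl ⟨⟨d, hd⟩, ⟨d', hd'⟩, g, x, y, hxy⟩)).trans_eq (Category.comp_id _)
  have ha' (d d' : D) (hd : d ∈ s) (hd' : d' ∈ s) (g : d ⟶ d') (x : W.obj d) (y : W.obj d')
      (hxy : y ≤ W.map g x) : a d' hd' y ≤ a d hd x ≫ F.map g := by
    exact (Category.comp_id _).ge.trans (hl (.inr ⟨⟨d, hd⟩, ⟨d', hd'⟩, g, x, y, hxy⟩))
  have hnat (d d' : D) (hd : d ∈ s) (hd' : d' ∈ s) (g : d ⟶ d') (x : W.obj d) :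
      a d' hd' (W.map g x) = a d hd x ≫ F.map g :=
    le_antisymm (ha' _ _ _ _ _ _ _ le_rfl) (ha _ _ _ _ _ _ _ le_rfl)
  have hmon (d : D) (hd : d ∈ s) (x y : W.obj d) (hxy : x ≤ y) : a d hd x ≤ a d hd y := by
    simpa using ha d d hd hd (𝟙 d) x y (by simpa using hxy)
  -- A cone is determined by its values on `s`, by transport along the chosen isomorphisms.
  have hcone {A : ExCompletion C} (c : WeightedCone W F A) (d : D) (x : W.obj d) :
      c.app d x = c.app (rep d) (W.map (e d).hom x) ≫ F.map (e d).inv := by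
    rw [c.naturality, Category.assoc, ← F.map_comp, Iso.hom_inv_id, F.map_id, Category.comp_id]
  let c : WeightedCone W F L :=
    { app := fun d x => a (rep d) (hrep d) (W.map (e d).hom x) ≫ F.map (e d).inv
      mono := fun d x y hxy => PosEnriched.comp_mono
        (hmon _ _ _ _ ((W.map (e d).hom).hom.monotone hxy)) le_rfl
      naturality := by
        intro d d' g x
        have h : W.map (e d').hom (W.map g x) =
            W.map ((e d).inv ≫ g ≫ (e d').hom) (W.map (e d).hom x) := by
          rw [← ConcreteCategory.comp_apply, ← ConcreteCategory.comp_apply, ← W.map_comp,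
            ← W.map_comp, Iso.hom_inv_id_assoc]
        rw [h, hnat _ _ (hrep d) (hrep d'), Category.assoc, Category.assoc, ← F.map_comp,
          ← F.map_comp]
        simp }
  -- For `d ∈ s`, `rep d` may differ from `d`; naturality within `s` shows that the transport still
  -- returns the original value.
  have hc (d : D) (hd : d ∈ s) (x : W.obj d) : c.app d x = a d hd x := by
    change a (rep d) (hrep d) (W.map (e d).hom x) ≫ F.map (e d).inv = _
    rw [hnat d _ hd, Category.assoc, ← F.map_comp, Iso.hom_inv_id, F.map_id, Category.comp_id]
  refine ⟨L, c, fun A => ⟨fun b => ?_, fun h h' => ⟨fun H => ?_, fun H d x => ?_⟩⟩⟩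
  · obtain ⟨h, hh⟩ := hex A (fun i => b.app i.1.1 i.2) (by
      rintro (⟨d, d', g, x, y, hxy⟩ | ⟨d, d', g, x, y, hxy⟩)
      · exact ((b.naturality g x).ge.trans (b.mono _ hxy)).trans_eq (Category.comp_id _).symm
      · exact (Category.comp_id _).le.trans ((b.mono _ hxy).trans_eq (b.naturality g x)))
    refine ⟨h, WeightedCone.ext (funext fun d => funext fun x => ?_)⟩
    rw [hcone b]
    exact (Category.assoc _ _ _).symm.trans (congrArg (· ≫ _) (hh ⟨⟨rep d, hrep d⟩, _⟩))
  · refine hmono A h h' fun i => ?_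
    have := H i.1.1 i.2
    simp only [WeightedCone.precomp, hc _ i.1.2] at this
    exact this
  · exact PosEnriched.comp_mono H le_rfl

end FiniteLimits

end ExCompletion

/-! ### `so`-morphisms -/

section So

variable {E : Type u} [Category.{v} E] [PosEnriched E]

/-- The order condition in the definition of an `so`-morphism is automatic. -/
theorem IsSo.of_exists_lift {A B : E} {e : A ⟶ B}
    (H : ∀ (X Y : E) (m : X ⟶ Y), IsOrderMono m → ∀ (a : A ⟶ X) (b : B ⟶ Y), a ≫ m = e ≫ b →
      ∃ w : B ⟶ X, e ≫ w = a ∧ w ≫ m = b) : IsSo e :=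
  fun X Y m hm => ⟨H X Y m hm, fun w w' _ h => hm _ w w' h⟩

theorem IsOrderMono.cancel {X Y Z : E} {m : X ⟶ Y} (hm : IsOrderMono m) {f g : Z ⟶ X}
    (h : f ≫ m = g ≫ m) : f = g :=
  le_antisymm (hm _ _ _ h.le) (hm _ _ _ h.ge)

/-- If a composite is an `so`-morphism, then so is its second factor. -/
theorem IsSo.of_comp {A B E' : E} {t : A ⟶ B} {e : B ⟶ E'} (h : IsSo (t ≫ e)) : IsSo e := by
  refine .of_exists_lift fun X Y m hm a b hab => ?_
  -- The filler for `t ≫ e` already has the correct lower triangle; cancelling `m` gives the upper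
  -- one.
  obtain ⟨w, -, hw⟩ := (h X Y m hm).1 (t ≫ a) b (by rw [Category.assoc, hab, Category.assoc])
  exact ⟨w, hm.cancel (by rw [Category.assoc, hw, hab]), hw⟩

theorem IsSoProjective.of_iso {P Q : E} (hP : IsSoProjective P) (i : P ≅ Q) :
    IsSoProjective Q := by
  intro X Y e he g
  obtain ⟨h, hh⟩ := hP X Y e he (i.hom ≫ g)
  have hh : h ≫ e = i.hom ≫ g := hh
  exact ⟨i.inv ≫ h, by simp [hh]⟩

/-- In a lifting square against an order-monomorphism `m`, the top arrow coinserts `f, g` because it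
does so after `m`. It thus factors through `q`, and cancelling `q` gives the other triangle. -/
theorem IsCoinserter.isSo {X Y Q : E} {f g : X ⟶ Y} {q : Y ⟶ Q} (h : IsCoinserter f g q) :
    IsSo q := by
  refine .of_exists_lift fun Z Z' m hm a b hab => ?_
  obtain ⟨w, rfl⟩ := h.2.1 Z a (hm _ _ _ (by
    rw [Category.assoc, Category.assoc, hab, ← Category.assoc, ← Category.assoc]
    exact PosEnriched.comp_mono h.1 le_rfl))
  rw [Category.assoc] at hab
  exact ⟨w, rfl, le_antisymm (h.2.2 _ _ _ hab.le) (h.2.2 _ _ _ hab.ge)⟩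

end So

/-! ### The canonical covers -/

namespace WeakCommaChoice

open ExCompletion

variable {C : Type u} [Category.{v} C] [PosEnriched C] (hC : WeaklyLex C) (I : WeakCommaChoice C)

theorem proj_comp_homMk {A B : ExCompletion C} (f : PreHom A B) :
    I.proj hC A ≫ homMk f = (I.gamma hC).map f.f ≫ I.proj hC B :=
  homMk_ext ((Category.id_comp f.f).trans (Category.comp_id f.f).symm)

theorem gamma_map_comp_proj_le_iff {X : C} {B : ExCompletion C} (f g : X ⟶ B.X) :
    (I.gamma hC).map f ≫ I.proj hC B ≤ (I.gamma hC).map g ≫ I.proj hC B ↔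
      ∃ σ : X ⟶ B.R, σ ≫ B.r₀ = f ∧ σ ≫ B.r₁ = g := by
  change (∃ σ : X ⟶ B.R, σ ≫ B.r₀ = f ≫ 𝟙 B.X ∧ σ ≫ B.r₁ = g ≫ 𝟙 B.X) ↔ _
  simp

/-- Every morphism out of `Γ X` factors through a canonical cover via the image of `Γ`. -/
theorem exists_gamma_map_comp_proj {X : C} {B : ExCompletion C} (φ : (I.gamma hC).obj X ⟶ B) :
    ∃ f : X ⟶ B.X, (I.gamma hC).map f ≫ I.proj hC B = φ := by
  obtain ⟨f, rfl⟩ := homMk_surjective φ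
  exact ⟨f.f, homMk_ext (Category.comp_id _)⟩

/-- A representative on `Γ A.X` descends to `A` exactly when it is compatible with the
pseudocongruences, which is what the coinserter inequality unfolds to. Uniqueness is immediate, as
the order on classes never mentions `A.R`. -/
theorem isCoinserter_proj (A : ExCompletion C) :
    IsCoinserter ((I.gamma hC).map A.r₀) ((I.gamma hC).map A.r₁) (I.proj hC A) := by
  refine ⟨(I.gamma_map_comp_proj_le_iff hC _ _).2 ⟨𝟙 _, Category.id_comp _, Category.id_comp _⟩,
    ?_, ?_⟩
  · intro Z h hle
    obtain ⟨f, rfl⟩ := I.exists_gamma_map_comp_proj hC h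
    rw [← Category.assoc, ← Category.assoc, ← Functor.map_comp, ← Functor.map_comp,
      gamma_map_comp_proj_le_iff] at hle
    exact ⟨homMk ⟨f, hle⟩, I.proj_comp_homMk hC _⟩
  · intro Z k k' hle
    obtain ⟨k, rfl⟩ := homMk_surjective k
    obtain ⟨k', rfl⟩ := homMk_surjective k'
    rwa [proj_comp_homMk, proj_comp_homMk, gamma_map_comp_proj_le_iff] at hle

theorem isSo_proj (A : ExCompletion C) : IsSo (I.proj hC A) :=
  (I.isCoinserter_proj hC A).isSo

/-- Order is reflected because a pair factoring through `I.i₀ Y ≤ I.i₁ Y` is itself ordered. -/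
theorem isFullyOrderFaithful_gamma : (I.gamma hC).IsFullyOrderFaithful := by
  refine fun X Y => ⟨fun φ => ?_, fun f g => ⟨?_, fun h => (I.gamma hC).map_mono h⟩⟩
  · obtain ⟨f, rfl⟩ := homMk_surjective φ
    exact ⟨f.f, rfl⟩
  · rintro ⟨σ, hσ₀, hσ₁⟩
    have hσ₀ : σ ≫ I.i₀ Y = f := hσ₀
    have hσ₁ : σ ≫ I.i₁ Y = g := hσ₁
    rw [← hσ₀, ← hσ₁]
    exact PosEnriched.comp_mono le_rfl (I.le Y)

end WeakCommaChoice

/-! ### Regularity of the exact completion -/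

section Regularity

open ExCompletion

variable {C : Type u} [Category.{v} C] [PosEnriched C]

/-- Factorizations into an `so`-morphism followed by an order-monomorphism. Moreover all morphisms
from objects `Γ X` lift along the first factor. -/
theorem ExCompletion.exists_factorization (hC : WeaklyLex C) {A B : ExCompletion C} (φ : A ⟶ B) :
    ∃ (Z : ExCompletion C) (e : A ⟶ Z) (m : Z ⟶ B),
      IsSo e ∧ IsOrderMono m ∧ e ≫ m = φ ∧
        ∀ (I : WeakCommaChoice C) (X : C) (g : (I.gamma hC).obj X ⟶ Z), ∃ t, t ≫ e = g := by
  obtain ⟨f, rfl⟩ := homMk_surjective φ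
  obtain ⟨R, r₀, r₁, ht, hr, hZ⟩ := exists_inverseImage hC (fun _ : Unit => B) (fun _ => f.f)
  simp only [forall_const] at hZ
  let Z : ExCompletion C := ⟨A.X, R, r₀, r₁, hr, ht⟩
  let e : PreHom A Z := ⟨𝟙 A.X, by simpa using (hZ A.R A.r₀ A.r₁).2 f.compat⟩
  let m : PreHom Z B := ⟨f.f, (hZ R r₀ r₁).1 ⟨𝟙 _, Category.id_comp _, Category.id_comp _⟩⟩
  -- `A` and `Z` share their underlying object, so the cover of `Z` passes through `e`; this yields
  -- both the `so`-property and the lifting clause.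
  have he (I : WeakCommaChoice C) : I.proj hC A ≫ homMk e = I.proj hC Z :=
    homMk_ext (Category.id_comp (𝟙 A.X))
  refine ⟨Z, homMk e, homMk m, ?_, ?_, homMk_ext (Category.id_comp f.f), fun I X g => ?_⟩
  · obtain ⟨I⟩ := hC.nonempty_weakCommaChoice
    exact IsSo.of_comp (he I ▸ I.isSo_proj hC Z)
  · intro Y g h hgh
    obtain ⟨g, rfl⟩ := homMk_surjective g
    obtain ⟨h, rfl⟩ := homMk_surjective h
    exact (hZ Y.X g.f h.f).2 hgh
  · obtain ⟨k, rfl⟩ := I.exists_gamma_map_comp_proj hC g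
    exact ⟨(I.gamma hC).map k ≫ I.proj hC A, by rw [Category.assoc, he]⟩

theorem WeakCommaChoice.isSoProjective_gamma (hC : WeaklyLex C) (I : WeakCommaChoice C) (A : C) :
    IsSoProjective ((I.gamma hC).obj A) := by
  intro X Y φ hφ g
  obtain ⟨Z, e, m, -, hm, rfl, hlift⟩ := exists_factorization hC φ
  -- The square with top `e` and bottom `𝟙 Y` has a filler `w`, which is a section of `m`.
  obtain ⟨w, -, hw⟩ := (hφ Z Y m hm).1 e (𝟙 Y) (Category.comp_id _).symm
  obtain ⟨t, ht⟩ := hlift I A (g ≫ w)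
  refine ⟨t, ?_⟩
  change t ≫ e ≫ m = g
  rw [← Category.assoc, ht, Category.assoc, hw, Category.comp_id]

theorem ExCompletion.isRegularPos (hC : WeaklyLex C) : IsRegularPos (ExCompletion C) where
  finitelyComplete := ExCompletion.finitelyComplete hC
  factorization f := by
    obtain ⟨Z, e, m, he, hm, h, -⟩ := ExCompletion.exists_factorization hC f
    exact ⟨Z, e, m, he, hm, h⟩
  so_stable := by
    intro P X Y Z p q f g hP hf
    obtain ⟨I⟩ := hC.nonempty_weakCommaChoice
    -- Lifting along `f` makes the canonical cover of `Y` factor through `q`, so `q` is the second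
    -- factor of an `so`-morphism.
    obtain ⟨u, hu⟩ := I.isSoProjective_gamma hC Y.X X Z f hf (I.proj hC Y ≫ g)
    obtain ⟨h, -, hh⟩ := hP.1.2 _ u (I.proj hC Y) hu
    exact IsSo.of_comp (t := h) (hh ▸ I.isSo_proj hC Y)

theorem WeakCommaChoice.isProjectiveCover_essImage (hC : WeaklyLex C) (I : WeakCommaChoice C) :
    IsProjectiveCover (I.gamma hC).toFunctor.essImage where
  regular := isRegularPos hC
  projective := by
    rintro X ⟨A, ⟨i⟩⟩
    exact (I.isSoProjective_gamma hC A).of_iso i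
  cover X := ⟨_, I.proj hC X, (I.gamma hC).toFunctor.obj_mem_essImage X.X, I.isSo_proj hC X⟩

end Regularity

theorem mainTheorem9 {C : Type u} [Category.{v} C] [PosEnriched C] (hC : WeaklyLex C) :
    Nonempty (WeakCommaChoice C) ∧
    ∀ I : WeakCommaChoice C,
      -- every `Γ A` is `so`-projective
      (∀ A : C, IsSoProjective ((I.gamma hC).obj A)) ∧
      -- `C` is a projective cover of `C_ex` via `Γ`
      (I.gamma hC).IsFullyOrderFaithful ∧
      IsProjectiveCover (I.gamma hC).toFunctor.essImage ∧
      -- every object `(X, R)` is the coinserter of `Γ R ⇉ Γ X`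
      (∀ A : ExCompletion C,
        IsSo (I.proj hC A) ∧
        IsCoinserter ((I.gamma hC).map A.r₀) ((I.gamma hC).map A.r₁) (I.proj hC A)) ∧
      -- every morphism is part of a commutative diagram between two such coinserters
      ∀ (A B : ExCompletion C) (φ : A ⟶ B),
        (∃ f : ExCompletion.PreHom A B, ExCompletion.homMk f = φ) ∧
        ∀ f : ExCompletion.PreHom A B, ExCompletion.homMk f = φ →
          (I.gamma hC).map f.f ≫ I.proj hC B = I.proj hC A ≫ φ ∧
          (∃ fbar : A.R ⟶ B.R, fbar ≫ B.r₀ = A.r₀ ≫ f.f ∧ fbar ≫ B.r₁ = A.r₁ ≫ f.f) ∧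
          ∀ fbar : A.R ⟶ B.R, fbar ≫ B.r₀ = A.r₀ ≫ f.f → fbar ≫ B.r₁ = A.r₁ ≫ f.f →
            (I.gamma hC).map fbar ≫ (I.gamma hC).map B.r₀ =
              (I.gamma hC).map A.r₀ ≫ (I.gamma hC).map f.f ∧
            (I.gamma hC).map fbar ≫ (I.gamma hC).map B.r₁ =
              (I.gamma hC).map A.r₁ ≫ (I.gamma hC).map f.f := by
  refine ⟨hC.nonempty_weakCommaChoice, fun I => ⟨I.isSoProjective_gamma hC,
    I.isFullyOrderFaithful_gamma hC, I.isProjectiveCover_essImage hC,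
    fun A => ⟨I.isSo_proj hC A, I.isCoinserter_proj hC A⟩, fun A B φ =>
    ⟨ExCompletion.homMk_surjective φ, ?_⟩⟩⟩
  rintro f rfl
  refine ⟨(I.proj_comp_homMk hC f).symm, f.compat, fun fbar h₀ h₁ => ?_⟩
  rw [← Functor.map_comp, ← Functor.map_comp, ← Functor.map_comp, ← Functor.map_comp, h₀, h₁]
  exact ⟨rfl, rfl⟩
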